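/- Let $k\ge 1$, let $Q_0,\dots,Q_k\in\mathbb{C}[w]$ with $Q_k\not\equiv 0$, and let $T=\sum_{j=0}^k Q_j(w)\frac{d^j}{dw^j}$ be non-degenerate, i.e. $\max_{0\le j\le k}(\deg Q_j-j)=\deg Q_k-k$ (with $\deg 0=-\infty$). A set $S\subset\mathbb{C}$ is called Hutchinson invariant in degree $n$ if it is closed and non-empty and, for every $z\in S$, all zeros of the polynomial $T[(w-z)^n]$ (in the variable $w$) lie in $S$. The minimal Hutchinson invariant set in degree $n$, if it exists, is the Hutchinson invariant set in degree $n$ that is contained in every other one; it is denoted $M_{H,n}$. Suppose that $Q_k$ has at least one simple zero. Then for every $\epsilon>0$ there is $N$ such that for all $n\ge N$: 1. $M_{H,n}$ exists, is contained in the $\epsilon$-neighbourhood of the set of zeros of $Q_k$, and contains all simple zeros of $Q_k$. 2. If $k\ge 2$, at least one $Q_j$ with $j\ne k$ is not identically zero, $\deg Q_k\ge 2$, and $Q_0,\dots,Q_k$ have no common zero in $\mathbb{C}$, then $M_{H,n}$ is a perfect set (it is closed and has no isolated point). -/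

import Mathlib

namespace Hutchinson

open Polynomial

/-- The linear differential operator `T = ∑_{j=0}^k Q_j(w) d^j/dw^j` on `ℂ[w]`.
Only `Q 0, …, Q k` matter. -/
noncomputable def diffOp (k : ℕ) (Q : ℕ → ℂ[X]) : ℂ[X] →ₗ[ℂ] ℂ[X] :=
  ∑ j ∈ Finset.range (k + 1), (LinearMap.mulLeft ℂ (Q j)) ∘ₗ (Polynomial.derivative ^ j)

/-- The operator has order `k` (that is, `Q_k ≠ 0`), and
`max_{0 ≤ j ≤ k} (deg Q_j - j) = deg Q_k - k`, where `deg 0 = -∞`. -/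
def NonDegenerate (k : ℕ) (Q : ℕ → ℂ[X]) : Prop :=
  Q k ≠ 0 ∧ ∀ j ≤ k, Q j ≠ 0 →
    ((Q j).natDegree : ℤ) - (j : ℤ) ≤ ((Q k).natDegree : ℤ) - (k : ℤ)

/-- `S ⊆ ℂ` is Hutchinson invariant in degree `n` for `T`: it is closed and non-empty, and for
every `z ∈ S` all zeros of `T[(w - z)^n]` lie in `S`. -/
def IsInvariant (T : ℂ[X] →ₗ[ℂ] ℂ[X]) (n : ℕ) (S : Set ℂ) : Prop :=
  IsClosed S ∧ S.Nonempty ∧ ∀ z ∈ S, ∀ w : ℂ, (T ((X - C z) ^ n)).IsRoot w → w ∈ S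

/-- `S` is the minimal Hutchinson invariant set of degree `n`: it is Hutchinson invariant in
degree `n` and contained in every other such set. -/
def IsMinimalInvariant (T : ℂ[X] →ₗ[ℂ] ℂ[X]) (n : ℕ) (S : Set ℂ) : Prop :=
  IsLeast {S' : Set ℂ | IsInvariant T n S'} S

end Hutchinson

/-! Up to the factor `(n)_k (w - z)^(n - k)`, `T[(w - z)^n]` equals `R_z = Q_k + ∑_{j<k} c_j Q_j (w
- z)^(k-j)` with `c_j = O(1/n)` (`residual`). Thus `R_z` is a small perturbation of `Q_k`, and
non-degeneracy fixes its degree `d = deg Q_k` for every `z`.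

For bounded `z` the roots of `R_z` lie near those of `Q_k` (`eventually_roots_near`), so a closed
neighbourhood of these is invariant. If `u` is a simple zero, `R_z(u)` is so small compared with `|u
- z|` that `R_z` has a root closer to `u` than `z` is (`eventually_exists_root_closer`). The point
of an invariant set nearest to `u` is then `u` itself, so the intersection of all invariant sets is
non-empty, hence minimal.

For perfectness, deleting an isolated `u` would leave a smaller invariant set, since no other point
produces `u`. So the derived set is non-empty; continuity of roots makes it invariant, and
minimality concludes (`IsMinimalInvariant.perfect`). -/

namespace Hutchinson

open Polynomial Filter Topology

/-! ### Roots and size of a complex polynomial. -/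

section Roots

lemma pow_card_le_prod_map {ι : Type*} (s : Multiset ι) (f : ι → ℝ) {a : ℝ} (ha : 0 ≤ a)
    (h : ∀ i ∈ s, a ≤ f i) : a ^ Multiset.card s ≤ (s.map f).prod := by
  induction s using Multiset.induction_on with
  | empty => simp
  | cons i s ih =>
    rw [Multiset.card_cons, pow_succ', Multiset.map_cons, Multiset.prod_cons]
    have h₁ := h i (Multiset.mem_cons_self i s)
    exact mul_le_mul h₁ (ih fun j hj => h j (Multiset.mem_cons_of_mem hj)) (by positivity)
      (ha.trans h₁)

lemma norm_eval_eq_prod (p : ℂ[X]) (x : ℂ) :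
    ‖p.eval x‖ = ‖p.leadingCoeff‖ * (p.roots.map fun r => ‖x - r‖).prod := by
  rw [(IsAlgClosed.splits p).eval_eq_prod_roots x, norm_mul]
  congr 1
  have := map_multiset_prod (normHom : ℂ →*₀ ℝ) (p.roots.map (x - ·))
  simpa [Multiset.map_map, Function.comp_def] using this

lemma card_roots_eq_natDegree (p : ℂ[X]) : Multiset.card p.roots = p.natDegree :=
  ((IsAlgClosed.splits p).natDegree_eq_card_roots).symm

/-- A nonconstant polynomial has a root nearest to a given point. -/
lemma exists_nearest_root {p : ℂ[X]} (hp : 0 < p.natDegree) (x : ℂ) :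
    ∃ r, p.IsRoot r ∧ ∀ s ∈ p.roots, ‖x - r‖ ≤ ‖x - s‖ := by
  have hne : p.roots.toFinset.Nonempty := by
    rw [Multiset.toFinset_nonempty, ← Multiset.card_pos, card_roots_eq_natDegree]
    exact hp
  obtain ⟨r, hr, hmin⟩ := p.roots.toFinset.exists_min_image (fun r => ‖x - r‖) hne
  exact ⟨r, isRoot_of_mem_roots (Multiset.mem_toFinset.1 hr),
    fun s hs => hmin s (Multiset.mem_toFinset.2 hs)⟩

lemma exists_root_pow_le {p : ℂ[X]} (hp : 0 < p.natDegree) (x : ℂ) :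
    ∃ r, p.IsRoot r ∧ ‖p.leadingCoeff‖ * ‖x - r‖ ^ p.natDegree ≤ ‖p.eval x‖ := by
  obtain ⟨r, hr, hmin⟩ := exists_nearest_root hp x
  refine ⟨r, hr, ?_⟩
  rw [norm_eval_eq_prod, ← card_roots_eq_natDegree]
  gcongr
  exact pow_card_le_prod_map _ _ (norm_nonneg _) hmin

/-- In `p'/p = ∑ 1/(x - r)` no term exceeds the inverse distance to the nearest root. -/
lemma exists_root_derivative_mul_le {p : ℂ[X]} (hp : 0 < p.natDegree) (x : ℂ) :
    ∃ r, p.IsRoot r ∧ ‖p.derivative.eval x‖ * ‖x - r‖ ≤ p.natDegree * ‖p.eval x‖ := by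
  by_cases hx : p.eval x = 0
  · exact ⟨x, hx, by simp [hx]⟩
  obtain ⟨r, hr, hmin⟩ := exists_nearest_root hp x
  refine ⟨r, hr, ?_⟩
  have hxr : 0 < ‖x - r‖ := by
    rw [norm_pos_iff, sub_ne_zero]
    rintro rfl
    exact hx hr
  have h₁ := (IsAlgClosed.splits p).eval_derivative_div_eval_of_ne_zero hx
  have h₂ : ‖p.derivative.eval x / p.eval x‖ ≤ p.natDegree * ‖x - r‖⁻¹ := by
    rw [h₁]
    refine (norm_multiset_sum_le _).trans ?_
    rw [Multiset.map_map, ← card_roots_eq_natDegree, ← nsmul_eq_mul]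
    refine (Multiset.sum_le_card_nsmul _ ‖x - r‖⁻¹ ?_).trans_eq (by simp)
    intro y hy
    obtain ⟨s, hs, rfl⟩ := Multiset.mem_map.1 hy
    have := hmin s hs
    simp only [Function.comp_apply, one_div, norm_inv]
    gcongr
  rw [norm_div, div_le_iff₀ (norm_pos_iff.2 hx)] at h₂
  calc ‖p.derivative.eval x‖ * ‖x - r‖
      ≤ p.natDegree * ‖x - r‖⁻¹ * ‖p.eval x‖ * ‖x - r‖ := by gcongr
    _ = p.natDegree * ‖p.eval x‖ := by field_simp

lemma exists_root_ne {p : ℂ[X]} (hp : 2 ≤ p.natDegree) {u : ℂ} (hu : p.IsRoot u)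
    (hd : p.derivative.eval u ≠ 0) : ∃ r, p.IsRoot r ∧ r ≠ u := by
  obtain ⟨q, hq⟩ := dvd_iff_isRoot.2 hu
  have hp0 : p ≠ 0 := by rintro rfl; simp at hp
  have hq0 : q ≠ 0 := by rintro rfl; simp [hp0] at hq
  have hdeg : q.degree ≠ 0 := by
    have h := congrArg natDegree hq
    rw [natDegree_mul (X_sub_C_ne_zero u) hq0, natDegree_X_sub_C] at h
    intro h0
    have : q.natDegree = 0 := natDegree_eq_of_degree_eq_some h0
    omega
  obtain ⟨r, hr⟩ := IsAlgClosed.exists_root q hdeg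
  refine ⟨r, by simp [hq, IsRoot.def.1 hr], ?_⟩
  rintro rfl
  apply hd
  simp [hq, IsRoot.def.1 hr]

lemma exists_norm_eval_le (p : ℂ[X]) :
    ∃ M : ℝ, 0 ≤ M ∧ ∀ w, ‖p.eval w‖ ≤ M * (1 + ‖w‖) ^ p.natDegree := by
  refine ⟨∑ i ∈ Finset.range (p.natDegree + 1), ‖p.coeff i‖, by positivity, fun w => ?_⟩
  rw [eval_eq_sum_range, Finset.sum_mul]
  refine (norm_sum_le _ _).trans (Finset.sum_le_sum fun i hi => ?_)
  rw [norm_mul, norm_pow]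
  gcongr
  have hw := norm_nonneg w
  calc ‖w‖ ^ i ≤ (1 + ‖w‖) ^ i := by gcongr; linarith
    _ ≤ (1 + ‖w‖) ^ p.natDegree :=
      pow_le_pow_right₀ (by linarith) (Nat.lt_succ_iff.1 (Finset.mem_range.1 hi))

lemma exists_le_norm_eval {p : ℂ[X]} (hp : p ≠ 0) {δ : ℝ} (hδ : 0 < δ) :
    ∃ c : ℝ, 0 < c ∧ ∀ w, (∀ r, p.IsRoot r → δ ≤ ‖w - r‖) →
      c * (1 + ‖w‖) ^ p.natDegree ≤ ‖p.eval w‖ := by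
  obtain ⟨R, hR⟩ : ∃ R : ℝ, ∀ r ∈ p.roots.toFinset, ‖r‖ ≤ R := by
    obtain ⟨R, hR⟩ := (p.roots.toFinset.image norm).exists_le
    exact ⟨R, fun r hr => hR _ (Finset.mem_image_of_mem _ hr)⟩
  -- Chosen so that `1 + ‖w‖ ≤ A * ‖w - r‖` for every root `r`.
  set A : ℝ := (1 + |R|) / δ + 1 with hA
  have hA0 : 0 < A := by positivity
  refine ⟨‖p.leadingCoeff‖ * A⁻¹ ^ p.natDegree,
    mul_pos (norm_pos_iff.2 (leadingCoeff_ne_zero.2 hp)) (by positivity), fun w hw => ?_⟩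
  rw [norm_eval_eq_prod, mul_assoc, ← mul_pow]
  gcongr
  conv_lhs => rw [← card_roots_eq_natDegree]
  refine pow_card_le_prod_map _ _ (by positivity) fun r hr => ?_
  have h₁ := hw r (isRoot_of_mem_roots hr)
  have h₂ := (hR r (Multiset.mem_toFinset.2 hr)).trans (le_abs_self R)
  have h₃ : ‖w‖ ≤ ‖w - r‖ + ‖r‖ := by simpa using norm_add_le (w - r) r
  rw [inv_mul_le_iff₀ hA0]
  have h₄ : 1 + |R| ≤ (1 + |R|) / δ * ‖w - r‖ := by
    rw [div_mul_eq_mul_div, le_div_iff₀ hδ]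
    gcongr
  rw [hA]
  linarith

end Roots

/-! ### The residual polynomial and its uniform closeness to `Q k`. -/

section Residual

/-- The ratio of falling factorials `(n)_j / (n)_k`. -/
noncomputable def weight (k n j : ℕ) : ℝ := n.descFactorial j / n.descFactorial k

lemma weight_nonneg (k n j : ℕ) : 0 ≤ weight k n j := by unfold weight; positivity

lemma weight_pos {k n j : ℕ} (hk : k ≤ n) (hj : j ≤ k) : 0 < weight k n j := by
  have h₁ := Nat.descFactorial_pos.2 hk
  have h₂ := Nat.descFactorial_pos.2 (hj.trans hk)
  unfold weight
  positivity

lemma weight_self {k n : ℕ} (hk : k ≤ n) : weight k n k = 1 :=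
  div_self (Nat.cast_ne_zero.2 (Nat.descFactorial_pos.2 hk).ne')

lemma weight_mul_weight {m k n : ℕ} (hmk : m ≤ k) (hk : k ≤ n) (j : ℕ) :
    weight k n m * weight m n j = weight k n j := by
  have h₁ : (n.descFactorial k : ℝ) ≠ 0 := Nat.cast_ne_zero.2 (Nat.descFactorial_pos.2 hk).ne'
  have h₂ : (n.descFactorial m : ℝ) ≠ 0 :=
    Nat.cast_ne_zero.2 (Nat.descFactorial_pos.2 (hmk.trans hk)).ne'
  unfold weight
  field_simp

/-- The inverse ratio is `(n - j)⋯(n - k + 1)`, whose last factor alone gives the bound. -/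
lemma weight_le {k n j : ℕ} (hj : j < k) (hk : k ≤ n) : weight k n j ≤ 1 / (n - k + 1 : ℝ) := by
  have hpos : (0 : ℝ) < n - k + 1 := by
    have : (k : ℝ) ≤ n := by exact_mod_cast hk
    linarith
  have h₁ := Nat.descFactorial_mul_descFactorial (n := n) hj.le
  have h₂ : n - k + 1 ≤ (n - j).descFactorial (k - j) := by
    obtain ⟨m, hm⟩ : ∃ m, k - j = m + 1 := ⟨k - j - 1, by omega⟩
    rw [hm, Nat.descFactorial_succ]
    have h₃ : 0 < (n - j).descFactorial m := Nat.descFactorial_pos.2 (by omega)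
    calc n - k + 1 = (n - j - m) * 1 := by omega
      _ ≤ _ := Nat.mul_le_mul_left _ h₃
  have h₄ : ((n : ℝ) - k + 1) * n.descFactorial j ≤ n.descFactorial k := by
    rw [← h₁]
    have : ((n - k + 1 : ℕ) : ℝ) = n - k + 1 := by push_cast [hk]; ring
    rw [← this]
    exact_mod_cast Nat.mul_le_mul_right _ h₂
  have h₅ : (0 : ℝ) < n.descFactorial k := by exact_mod_cast Nat.descFactorial_pos.2 hk
  unfold weight
  rw [div_le_div_iff₀ h₅ hpos]
  linarith

lemma eventually_weight_le (k : ℕ) {η : ℝ} (hη : 0 < η) :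
    ∀ᶠ n : ℕ in atTop, k ≤ n ∧ ∀ j < k, weight k n j ≤ η := by
  obtain ⟨m, hm⟩ := exists_nat_one_div_lt hη
  filter_upwards [eventually_ge_atTop (k + m)] with n hn
  have hkn : k ≤ n := by omega
  refine ⟨hkn, fun j hj => (weight_le hj hkn).trans (le_trans ?_ hm.le)⟩
  have : (k : ℝ) + m ≤ n := by exact_mod_cast hn
  gcongr
  linarith

/-- The cofactor of `(w - z)^(n - k)` in `T[(w - z)^n]`, normalized by `(n)_k`. -/
noncomputable def residual (k : ℕ) (Q : ℕ → ℂ[X]) (n : ℕ) (z : ℂ) : ℂ[X] :=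
  ∑ j ∈ Finset.range (k + 1), (weight k n j : ℂ) • (Q j * (X - C z) ^ (k - j))

variable {k : ℕ} {Q : ℕ → ℂ[X]} {n : ℕ}

lemma diffOp_X_sub_C_pow (hk : k ≤ n) (z : ℂ) :
    diffOp k Q ((X - C z) ^ n) =
      (n.descFactorial k : ℂ) • ((X - C z) ^ (n - k) * residual k Q n z) := by
  simp only [diffOp, residual, LinearMap.sum_apply, Finset.mul_sum, Finset.smul_sum]
  refine Finset.sum_congr rfl fun j hj => ?_
  have hj' : j ≤ k := Nat.lt_succ_iff.1 (Finset.mem_range.1 hj)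
  have h₁ : (n.descFactorial k : ℂ) ≠ 0 := Nat.cast_ne_zero.2 (Nat.descFactorial_pos.2 hk).ne'
  have h₂ : (n.descFactorial k : ℂ) * (weight k n j : ℂ) = n.descFactorial j := by
    unfold weight
    push_cast
    field_simp
  rw [LinearMap.comp_apply, Module.End.pow_apply, iterate_derivative_X_sub_pow,
    LinearMap.mulLeft_apply, mul_smul_comm, mul_smul_comm, smul_smul, h₂,
    ← Nat.cast_smul_eq_nsmul ℂ, show n - j = (n - k) + (k - j) by omega, pow_add]
  congr 1
  ring

lemma isRoot_diffOp_iff (hk : k < n) (z w : ℂ) :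
    (diffOp k Q ((X - C z) ^ n)).IsRoot w ↔ w = z ∨ (residual k Q n z).IsRoot w := by
  have h₁ : (n.descFactorial k : ℂ) ≠ 0 :=
    Nat.cast_ne_zero.2 (Nat.descFactorial_pos.2 hk.le).ne'
  have h₂ : n - k ≠ 0 := by omega
  rw [diffOp_X_sub_C_pow hk.le]
  simp [IsRoot.def, h₁, h₂, sub_eq_zero]

lemma eval_residual (z w : ℂ) : (residual k Q n z).eval w =
    ∑ j ∈ Finset.range (k + 1), (weight k n j : ℂ) * ((Q j).eval w * (w - z) ^ (k - j)) := by
  simp [residual, eval_finsetSum]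

/-- Any linear functional of the residual is close to its value at `Q k`. -/
lemma norm_apply_residual_sub_le (φ : ℂ[X] →ₗ[ℂ] ℂ) {η : ℝ} (hk : k ≤ n)
    (hη : ∀ j < k, weight k n j ≤ η) (z : ℂ) :
    ‖φ (residual k Q n z) - φ (Q k)‖ ≤
      ∑ j ∈ Finset.range k, η * ‖φ (Q j * (X - C z) ^ (k - j))‖ := by
  have : φ (residual k Q n z) - φ (Q k) =
      ∑ j ∈ Finset.range k, (weight k n j : ℂ) * φ (Q j * (X - C z) ^ (k - j)) := by
    simp [residual, Finset.sum_range_succ, weight_self hk]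
  rw [this]
  refine (norm_sum_le _ _).trans (Finset.sum_le_sum fun j hj => ?_)
  rw [norm_mul, Complex.norm_real, Real.norm_of_nonneg (weight_nonneg _ _ _)]
  gcongr
  exact hη j (Finset.mem_range.1 hj)

/-- If the values of `φ` on the terms of lower order are bounded by `M * F z`, then `φ` of the
residual differs from `φ (Q k)` by at most `ε * F z` for large degrees. -/
lemma eventually_norm_apply_residual_sub_le {ι : Type*} (φ : ι → ℂ[X] →ₗ[ℂ] ℂ) (z : ι → ℂ)
    (F : ι → ℝ) (hF : ∀ i, 0 ≤ F i) (M : ℕ → ℝ)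
    (hM : ∀ j < k, ∀ i, ‖φ i (Q j * (X - C (z i)) ^ (k - j))‖ ≤ M j * F i) {ε : ℝ} (hε : 0 < ε) :
    ∀ᶠ n in atTop, ∀ i, ‖φ i (residual k Q n (z i)) - φ i (Q k)‖ ≤ ε * F i := by
  obtain ⟨η, hη, hηM⟩ := exists_pos_mul_lt hε (∑ j ∈ Finset.range k, M j)
  filter_upwards [eventually_weight_le k hη] with n hn i
  refine (norm_apply_residual_sub_le (φ i) hn.1 hn.2 (z i)).trans ?_
  calc ∑ j ∈ Finset.range k, η * ‖φ i (Q j * (X - C (z i)) ^ (k - j))‖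
      ≤ ∑ j ∈ Finset.range k, η * (M j * F i) := by
        gcongr with j hj
        exact hM j (Finset.mem_range.1 hj) i
    _ = (∑ j ∈ Finset.range k, M j) * η * F i := by
        rw [← Finset.mul_sum, ← Finset.sum_mul]
        ring
    _ ≤ ε * F i := mul_le_mul_of_nonneg_right hηM.le (hF i)

lemma NonDegenerate.natDegree_add_le (hT : NonDegenerate k Q) {j : ℕ} (hj : j ≤ k)
    (h0 : Q j ≠ 0) : (Q j).natDegree + (k - j) ≤ (Q k).natDegree := by
  have := hT.2 j hj h0
  omega

lemma natDegree_residual_le (hT : NonDegenerate k Q) (z : ℂ) :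
    (residual k Q n z).natDegree ≤ (Q k).natDegree := by
  refine natDegree_sum_le_of_forall_le _ _ fun j hj => (natDegree_smul_le _ _).trans ?_
  by_cases h0 : Q j = 0
  · simp [h0]
  refine natDegree_mul_le.trans (le_trans ?_
    (hT.natDegree_add_le (Nat.lt_succ_iff.1 (Finset.mem_range.1 hj)) h0))
  gcongr
  simp

/-- Only the top coefficient of `(X - C z)^(k - j)` can contribute. The result is free of `z`, which
makes the leading-coefficient estimate uniform over the whole plane. -/
lemma NonDegenerate.coeff_mul_pow (hT : NonDegenerate k Q) {j : ℕ} (hj : j ≤ k) (z : ℂ) :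
    (Q j * (X - C z) ^ (k - j)).coeff (Q k).natDegree =
      (Q j).coeff ((Q k).natDegree - (k - j)) := by
  by_cases h0 : Q j = 0
  · simp [h0]
  have h := hT.natDegree_add_le hj h0
  conv_lhs => rw [show (Q k).natDegree = ((Q k).natDegree - (k - j)) + (k - j) by omega]
  have hm : ((X - C z) ^ (k - j)).natDegree = k - j := by simp
  rw [coeff_mul_add_eq_of_natDegree_le (by omega) hm.le]
  have : ((X - C z) ^ (k - j)).coeff (k - j) = 1 := by
    simpa [hm] using ((monic_X_sub_C z).pow (k - j)).coeff_natDegree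
  rw [this, mul_one]

lemma eventually_natDegree_residual (hT : NonDegenerate k Q) :
    ∀ᶠ n in atTop, ∀ z, (residual k Q n z).natDegree = (Q k).natDegree ∧
      ‖(Q k).leadingCoeff‖ / 2 ≤ ‖(residual k Q n z).leadingCoeff‖ := by
  have hq : 0 < ‖(Q k).leadingCoeff‖ := norm_pos_iff.2 (leadingCoeff_ne_zero.2 hT.1)
  have h := eventually_norm_apply_residual_sub_le (k := k) (Q := Q) (ι := ℂ)
    (fun _ => lcoeff ℂ (Q k).natDegree) id (fun _ => 1) (fun _ => zero_le_one)
    (fun j => ‖(Q j).coeff ((Q k).natDegree - (k - j))‖)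
    (fun j hj z => by simp [hT.coeff_mul_pow hj.le]) (half_pos hq)
  filter_upwards [h] with n hn z
  have h₁ := hn z
  simp only [lcoeff_apply, id, mul_one, coeff_natDegree] at h₁
  have h₂ : ‖(Q k).leadingCoeff‖ / 2 ≤ ‖(residual k Q n z).coeff (Q k).natDegree‖ := by
    have := norm_sub_norm_le (Q k).leadingCoeff ((residual k Q n z).coeff (Q k).natDegree)
    rw [norm_sub_rev] at this
    linarith
  have h₃ : (residual k Q n z).natDegree = (Q k).natDegree := by
    refine le_antisymm (natDegree_residual_le hT z) (le_natDegree_of_ne_zero ?_)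
    rw [← norm_pos_iff]
    linarith
  exact ⟨h₃, h₂.trans_eq (by rw [leadingCoeff, h₃])⟩

end Residual

/-! ### Location of the roots; existence of the minimal set. -/

section Localization

variable {k : ℕ} {Q : ℕ → ℂ[X]} {n : ℕ}

/-- For `z` in a bounded region and `n` large, the roots of the residual lie near those of
`Q k`. -/
lemma eventually_roots_near (hT : NonDegenerate k Q) {δ : ℝ} (hδ : 0 < δ) {B : ℝ} (hB : 0 ≤ B) :
    ∀ᶠ n in atTop, ∀ z : ℂ, ‖z‖ ≤ B → ∀ w, (residual k Q n z).IsRoot w →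
      ∃ r, (Q k).IsRoot r ∧ ‖w - r‖ < δ := by
  obtain ⟨c, hc, hcw⟩ := exists_le_norm_eval hT.1 hδ
  choose M hM0 hM using fun j => exists_norm_eval_le (Q j)
  have h := eventually_norm_apply_residual_sub_le (k := k) (Q := Q)
    (ι := {p : ℂ × ℂ // ‖p.1‖ ≤ B}) (fun p => leval p.1.2) (fun p => p.1.1)
    (fun p => (1 + ‖p.1.2‖) ^ (Q k).natDegree) (fun p => by positivity)
    (fun j => M j * (1 + B) ^ (k - j)) ?_ (half_pos hc)
  · filter_upwards [h] with n hn z hz w hw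
    by_contra! hfar
    have h₁ := hn ⟨(z, w), hz⟩
    have h₂ := hcw w hfar
    simp only [leval_apply, IsRoot.def.1 hw, zero_sub, norm_neg] at h₁
    have h₃ : 0 < (1 + ‖w‖) ^ (Q k).natDegree := by positivity
    nlinarith
  · rintro j hj ⟨⟨z, w⟩, hz⟩
    simp only [leval_apply, eval_mul, eval_pow, eval_sub, eval_X, eval_C, norm_mul, norm_pow]
    by_cases h0 : Q j = 0
    · simp only [h0, eval_zero, norm_zero, zero_mul]
      have := hM0 j
      positivity
    have hw := norm_nonneg w
    -- Each power of `w - z` costs one power of `1 + ‖w‖`; non-degeneracy keeps the total at most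
    -- `deg Q_k`, so the estimate holds for unbounded `w`.
    have h₁ : ‖w - z‖ ≤ (1 + B) * (1 + ‖w‖) := by
      have := norm_sub_le w z
      have := mul_nonneg hB hw
      dsimp only at hz
      linarith
    calc ‖(Q j).eval w‖ * ‖w - z‖ ^ (k - j)
        ≤ M j * (1 + ‖w‖) ^ (Q j).natDegree * ((1 + B) * (1 + ‖w‖)) ^ (k - j) := by
          have := hM0 j
          gcongr
          exact hM j w
      _ = M j * (1 + B) ^ (k - j) * (1 + ‖w‖) ^ ((Q j).natDegree + (k - j)) := by
          rw [mul_pow, pow_add]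
          ring
      _ ≤ M j * (1 + B) ^ (k - j) * (1 + ‖w‖) ^ (Q k).natDegree := by
          have := hM0 j
          have := hT.natDegree_add_le hj.le h0
          gcongr
          linarith

lemma simple_root_iff {p : ℂ[X]} (hp : p ≠ 0) (u : ℂ) :
    p.rootMultiplicity u = 1 ↔ p.IsRoot u ∧ p.derivative.eval u ≠ 0 := by
  have h₁ := one_lt_rootMultiplicity_iff_isRoot (t := u) hp
  have h₂ := rootMultiplicity_pos (x := u) hp
  rw [IsRoot.def] at *
  constructor
  · intro h
    have h₃ : p.eval u = 0 := h₂.1 (by omega)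
    exact ⟨h₃, fun h₄ => by have := h₁.2 ⟨h₃, h₄⟩; omega⟩
  · rintro ⟨h₃, h₄⟩
    have h₅ := h₂.2 h₃
    by_contra h₆
    exact h₄ (h₁.1 (by omega)).2

lemma eventually_derivative_ne {u : ℂ} (hu : (Q k).derivative.eval u ≠ 0) :
    ∀ᶠ n in atTop, ∀ z : ℂ, ‖u - z‖ ≤ 1 →
      ‖(Q k).derivative.eval u‖ / 2 ≤ ‖(residual k Q n z).derivative.eval u‖ := by
  have h := eventually_norm_apply_residual_sub_le (k := k) (Q := Q)
    (ι := {z : ℂ // ‖u - z‖ ≤ 1}) (fun _ => leval u ∘ₗ derivative) (fun z => z)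
    (fun _ => 1) (fun _ => zero_le_one)
    (fun j => ‖(Q j).derivative.eval u‖ + ‖(Q j).eval u‖ * (k - j : ℕ)) ?_
    (half_pos (norm_pos_iff.2 hu))
  · filter_upwards [h] with n hn z hz
    have h₁ := hn ⟨z, hz⟩
    simp only [LinearMap.comp_apply, leval_apply, mul_one] at h₁
    have := norm_sub_norm_le ((Q k).derivative.eval u) ((residual k Q n z).derivative.eval u)
    rw [norm_sub_rev] at this
    linarith
  · rintro j hj ⟨z, hz⟩
    simp only [LinearMap.comp_apply, leval_apply, derivative_mul, derivative_X_sub_C_pow,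
      eval_add, eval_mul, eval_pow, eval_sub, eval_X, eval_C, mul_one]
    refine (norm_add_le _ _).trans ?_
    simp only [norm_mul, norm_pow, Complex.norm_natCast]
    have h₁ : ∀ m : ℕ, ‖u - z‖ ^ m ≤ 1 := fun m => pow_le_one₀ (norm_nonneg _) hz
    gcongr
    · exact mul_le_of_le_one_right (norm_nonneg _) (h₁ _)
    · exact mul_le_of_le_one_right (Nat.cast_nonneg _) (h₁ _)

/-- A simple root `u` of `Q k` attracts: from any other point `z`, some root of the residual is
closer to `u`. -/
lemma eventually_exists_root_closer (hT : NonDegenerate k Q) {u : ℂ}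
    (hu : (Q k).rootMultiplicity u = 1) :
    ∀ᶠ n in atTop, ∀ z ≠ u, ∃ w, (residual k Q n z).IsRoot w ∧ ‖u - w‖ < ‖u - z‖ := by
  obtain ⟨hu0, hu1⟩ := (simple_root_iff hT.1 u).1 hu
  have hq : 0 < ‖(Q k).leadingCoeff‖ := norm_pos_iff.2 (leadingCoeff_ne_zero.2 hT.1)
  have hd : 0 < (Q k).natDegree := by
    refine natDegree_pos_iff_degree_pos.2 (degree_pos_of_root hT.1 hu0)
  have hd' : (0 : ℝ) < (Q k).natDegree := by exact_mod_cast hd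
  have hD : 0 < ‖(Q k).derivative.eval u‖ := norm_pos_iff.2 hu1
  have hfar := eventually_norm_apply_residual_sub_le (k := k) (Q := Q)
    (ι := {z : ℂ // 1 ≤ ‖u - z‖}) (fun _ => leval u) (fun z => z)
    (fun z => ‖u - z‖ ^ (Q k).natDegree) (fun _ => by positivity)
    (fun j => ‖(Q j).eval u‖) ?_ (half_pos (half_pos hq))
  · have hnear := eventually_norm_apply_residual_sub_le (k := k) (Q := Q)
      (ι := {z : ℂ // ‖u - z‖ ≤ 1}) (fun _ => leval u) (fun z => z)
      (fun z => ‖u - z‖) (fun _ => by positivity)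
      (fun j => ‖(Q j).eval u‖) ?_ (div_pos (half_pos (half_pos hD)) hd')
    · filter_upwards [hfar, hnear, eventually_natDegree_residual hT,
        eventually_derivative_ne hu1] with n hn₁ hn₂ hn₃ hn₄ z hz
      have hpos : 0 < ‖u - z‖ := norm_pos_iff.2 (sub_ne_zero.2 hz.symm)
      simp only [leval_apply, IsRoot.def.1 hu0, sub_zero, Subtype.forall] at hn₁ hn₂
      obtain ⟨hdeg, hlead⟩ := hn₃ z
      have hdeg0 : 0 < (residual k Q n z).natDegree := hdeg.symm ▸ hd
      -- Far away the product of the root distances gives `‖u - r‖^d ≤ ‖u - z‖^d / 2`; nearby the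
      -- logarithmic derivative gives `‖u - r‖ ≤ ‖u - z‖ / 2`.
      rcases le_total 1 ‖u - z‖ with h | h
      · obtain ⟨r, hr, hle⟩ := exists_root_pow_le hdeg0 u
        refine ⟨r, hr, lt_of_pow_lt_pow_left₀ (Q k).natDegree hpos.le ?_⟩
        rw [hdeg] at hle
        have h₁ := hn₁ z h
        have h₂ : 0 < ‖u - z‖ ^ (Q k).natDegree := by positivity
        have h₃ : 0 ≤ ‖u - r‖ ^ (Q k).natDegree := by positivity
        by_contra! h₄
        have h₅ := mul_le_mul hlead h₄ h₂.le (norm_nonneg _)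
        nlinarith
      · obtain ⟨r, hr, hle⟩ := exists_root_derivative_mul_le hdeg0 u
        refine ⟨r, hr, ?_⟩
        rw [hdeg] at hle
        have h₁ := hn₂ z h
        have h₂ := hn₄ z h
        rw [div_mul_eq_mul_div, le_div_iff₀ hd'] at h₁
        by_contra! h₄
        have h₅ := mul_le_mul h₂ h₄ hpos.le (norm_nonneg _)
        nlinarith
    · rintro j hj ⟨z, hz⟩
      simp only [leval_apply, eval_mul, eval_pow, eval_sub, eval_X, eval_C, norm_mul, norm_pow]
      gcongr
      exact pow_le_of_le_one (norm_nonneg _) hz (by omega)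
  · rintro j hj ⟨z, hz⟩
    simp only [leval_apply, eval_mul, eval_pow, eval_sub, eval_X, eval_C, norm_mul, norm_pow]
    by_cases h0 : Q j = 0
    · simp [h0]
    have := hT.natDegree_add_le hj.le h0
    exact mul_le_mul_of_nonneg_left (pow_le_pow_right₀ hz (by omega)) (norm_nonneg _)

lemma IsInvariant.mem_of_closer {T : ℂ[X] →ₗ[ℂ] ℂ[X]} {S : Set ℂ} (hS : IsInvariant T n S)
    {u : ℂ} (h : ∀ z ≠ u, ∃ w, (T ((X - C z) ^ n)).IsRoot w ∧ ‖u - w‖ < ‖u - z‖) : u ∈ S := by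
  obtain ⟨hcl, hne, hinv⟩ := hS
  obtain ⟨z, hz, hdist⟩ := hcl.exists_infDist_eq_dist hne u
  by_contra hu
  obtain ⟨w, hw, hlt⟩ := h z (by rintro rfl; exact hu hz)
  have := Metric.infDist_le_dist_of_mem (x := u) (hinv z hz w hw)
  rw [hdist, dist_eq_norm, dist_eq_norm] at this
  linarith

/-- Non-emptiness is the only condition that an intersection may lose; `u` secures it. -/
lemma isMinimalInvariant_sInter {T : ℂ[X] →ₗ[ℂ] ℂ[X]} {u : ℂ}
    (hu : ∀ S, IsInvariant T n S → u ∈ S) :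
    IsMinimalInvariant T n (⋂₀ {S | IsInvariant T n S}) :=
  ⟨⟨isClosed_sInter fun _ hS => hS.1, ⟨u, Set.mem_sInter.2 hu⟩, fun z hz w hw =>
    Set.mem_sInter.2 fun S hS => hS.2.2 z (Set.mem_sInter.1 hz S hS) w hw⟩,
    fun _ hS => Set.sInter_subset_of_mem hS⟩

/-- The closed neighbourhood of the roots of `Q k` is invariant in large degrees. -/
lemma eventually_isInvariant_neighbourhood (hT : NonDegenerate k Q) (hd : ∃ u, (Q k).IsRoot u)
    {δ : ℝ} (hδ : 0 < δ) :
    ∀ᶠ n in atTop, IsInvariant (diffOp k Q) n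
      (⋃ r ∈ {w | (Q k).IsRoot w}, Metric.closedBall r δ) := by
  have hfin : {w | (Q k).IsRoot w}.Finite := by
    refine ((Q k).roots.toFinset.finite_toSet).subset fun w hw => ?_
    simpa [hT.1] using hw
  have hcomp : IsCompact (⋃ r ∈ {w | (Q k).IsRoot w}, Metric.closedBall r δ) :=
    hfin.isCompact_biUnion fun r _ => isCompact_closedBall r δ
  obtain ⟨B, hB⟩ := hcomp.isBounded.exists_norm_le
  filter_upwards [eventually_roots_near hT hδ (abs_nonneg B), eventually_gt_atTop k] with n hn hk
  refine ⟨hcomp.isClosed, ?_, fun z hz w hw => ?_⟩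
  · obtain ⟨u, hu⟩ := hd
    exact ⟨u, Set.mem_biUnion hu (Metric.mem_closedBall_self hδ.le)⟩
  · rcases (isRoot_diffOp_iff hk z w).1 hw with rfl | hw
    · exact hz
    · obtain ⟨r, hr, hlt⟩ := hn z ((hB z hz).trans (le_abs_self B)) w hw
      exact Set.mem_biUnion hr (by simpa [dist_eq_norm] using hlt.le)

end Localization

/-! ### Absence of isolated points. -/

section Perfectness

variable {k : ℕ} {Q : ℕ → ℂ[X]} {n : ℕ}

/-- The surviving terms share the factor `(u - z)^(k - m)`; dividing it out leaves the operator
truncated at order `m`, whose top coefficient may be nonzero at `u` even when `Q k` vanishes there.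
-/
lemma eval_residual_of_vanishing {m : ℕ} (hm : m ≤ k) (hk : k ≤ n) {u : ℂ}
    (h : ∀ j, m < j → j ≤ k → (Q j).eval u = 0) (z : ℂ) :
    (residual k Q n z).eval u =
      weight k n m * (u - z) ^ (k - m) * (residual m Q n z).eval u := by
  rw [eval_residual, eval_residual, Finset.mul_sum]
  symm
  refine Finset.sum_subset_zero_on_sdiff
    (Finset.range_subset_range.2 (Nat.succ_le_succ hm)) (fun j hj => ?_) fun j hj => ?_
  · simp only [Finset.mem_sdiff, Finset.mem_range] at hj
    rw [h j (by omega) (by omega)]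
    simp
  · have hj' : j ≤ m := Nat.lt_succ_iff.1 (Finset.mem_range.1 hj)
    rw [← weight_mul_weight hm hk j, show k - j = (k - m) + (m - j) by omega, pow_add]
    push_cast
    ring

/-- If the coefficients have no common zero, a point `u` is not a root of the residual at any
other point of a bounded region. -/
lemma eventually_not_isRoot {u : ℂ} (hu : ∃ j ≤ k, ¬ (Q j).IsRoot u) {B : ℝ} :
    ∀ᶠ n in atTop, ∀ z ≠ u, ‖u - z‖ ≤ B → ¬ (residual k Q n z).IsRoot u := by
  classical
  obtain ⟨j₀, hj₀, hne⟩ := hu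
  set m := Nat.findGreatest (fun j => ¬ (Q j).IsRoot u) k
  have hmk : m ≤ k := Nat.findGreatest_le k
  have hmne : (Q m).eval u ≠ 0 :=
    Nat.findGreatest_spec (P := fun j => ¬ (Q j).IsRoot u) hj₀ hne
  have hvan : ∀ j, m < j → j ≤ k → (Q j).eval u = 0 := fun j h₁ h₂ => by
    have := Nat.findGreatest_is_greatest h₁ h₂
    simpa using this
  have h := eventually_norm_apply_residual_sub_le (k := m) (Q := Q)
    (ι := {z : ℂ // ‖u - z‖ ≤ B}) (fun _ => leval u) (fun z => z)
    (fun _ => 1) (fun _ => zero_le_one)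
    (fun j => ‖(Q j).eval u‖ * B ^ (m - j)) ?_ (half_pos (norm_pos_iff.2 hmne))
  · filter_upwards [h, eventually_ge_atTop k] with n hn hk z hz hzB hroot
    rw [IsRoot.def, eval_residual_of_vanishing hmk hk hvan, mul_eq_zero, mul_eq_zero] at hroot
    rcases hroot with (h₁ | h₁) | h₁
    · exact (weight_pos hk hmk).ne' (by exact_mod_cast h₁)
    · exact hz (sub_eq_zero.1 (eq_zero_of_pow_eq_zero h₁)).symm
    · have h₂ := hn ⟨z, hzB⟩
      simp only [leval_apply, h₁, zero_sub, norm_neg, mul_one] at h₂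
      have := norm_pos_iff.2 hmne
      linarith
  · rintro j hj ⟨z, hz⟩
    simp only [leval_apply, eval_mul, eval_pow, eval_sub, eval_X, eval_C, norm_mul, norm_pow,
      mul_one]
    gcongr

/-- With `x` fixed, the value at `x` is a nonzero polynomial in `x - z`. -/
lemma finite_setOf_residual_isRoot (hk : k ≤ n) {x : ℂ} (hx : ∃ j ≤ k, ¬ (Q j).IsRoot x) :
    {z | (residual k Q n z).IsRoot x}.Finite := by
  obtain ⟨j, hj, hne⟩ := hx
  set R : ℂ[X] := ∑ i ∈ Finset.range (k + 1),
    C ((weight k n i : ℂ) * (Q i).eval x) * X ^ (k - i) with hR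
  have hR0 : R ≠ 0 := by
    intro h0
    have hc : R.coeff (k - j) = (weight k n j : ℂ) * (Q j).eval x := by
      rw [hR, finsetSum_coeff, Finset.sum_eq_single_of_mem j (Finset.mem_range.2 (by omega))]
      · rw [coeff_C_mul_X_pow, if_pos rfl]
      · intro i hi hij
        have := Finset.mem_range.1 hi
        rw [coeff_C_mul_X_pow, if_neg (by omega)]
    rw [h0, coeff_zero, eq_comm, mul_eq_zero] at hc
    rcases hc with hc | hc
    · exact (weight_pos hk hj).ne' (by exact_mod_cast hc)
    · exact hne hc
  have hfin : {t | R.IsRoot t}.Finite := by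
    refine (R.roots.toFinset.finite_toSet).subset fun w hw => ?_
    simpa [hR0] using hw
  have hinj : Function.Injective (fun z : ℂ => x - z) := sub_right_injective
  refine (hfin.preimage hinj.injOn).subset fun z hz => ?_
  rw [Set.mem_ofPred_eq, IsRoot.def, eval_residual] at hz
  rw [Set.mem_preimage, Set.mem_ofPred_eq, IsRoot.def, ← hz, hR, eval_finsetSum]
  refine Finset.sum_congr rfl fun i _ => ?_
  simp [mul_assoc]

/-- Roots of the residual persist under small changes of `z`. -/
lemma eventually_exists_root_near {z x : ℂ} (hx : (residual k Q n z).IsRoot x) {d : ℕ}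
    (hd : 0 < d) {c : ℝ} (hc : 0 < c) (hdeg : ∀ z, (residual k Q n z).natDegree = d ∧
      c ≤ ‖(residual k Q n z).leadingCoeff‖) {δ : ℝ} (hδ : 0 < δ) :
    ∀ᶠ z' in 𝓝 z, ∃ r, (residual k Q n z').IsRoot r ∧ ‖x - r‖ < δ := by
  have hcont : Continuous fun z' => ‖(residual k Q n z').eval x‖ := by
    simp only [eval_residual]
    fun_prop
  have hlim := hcont.tendsto z
  rw [IsRoot.def.1 hx, norm_zero] at hlim
  filter_upwards [hlim.eventually_lt_const (show 0 < c * δ ^ d by positivity)] with z' hz'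
  obtain ⟨r, hr, hle⟩ := exists_root_pow_le ((hdeg z').1.symm ▸ hd) x
  refine ⟨r, hr, lt_of_pow_lt_pow_left₀ d hδ.le ?_⟩
  rw [(hdeg z').1] at hle
  have h₁ := mul_le_mul_of_nonneg_right (hdeg z').2 (pow_nonneg (norm_nonneg (x - r)) d)
  exact lt_of_mul_lt_mul_left (by linarith) hc.le

lemma IsMinimalInvariant.perfect {M : Set ℂ} (hM : IsMinimalInvariant (diffOp k Q) n M)
    (hk : k < n) {d : ℕ} (hd : 0 < d) {c : ℝ} (hc : 0 < c)
    (hdeg : ∀ z, (residual k Q n z).natDegree = d ∧ c ≤ ‖(residual k Q n z).leadingCoeff‖)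
    (hcommon : ∀ w, ∃ j ≤ k, ¬ (Q j).IsRoot w) {u : ℂ} (hu : u ∈ M)
    (hother : ∃ w, (residual k Q n u).IsRoot w ∧ w ≠ u)
    (hback : ∀ z ∈ M, z ≠ u → ¬ (residual k Q n z).IsRoot u) : Perfect M := by
  obtain ⟨⟨hcl, -, hinv⟩, hmin⟩ := hM
  have hinv' : ∀ z ∈ M, ∀ w, (residual k Q n z).IsRoot w → w ∈ M := fun z hz w hw =>
    hinv z hz w ((isRoot_diffOp_iff hk z w).2 (Or.inr hw))
  have hacc : AccPt u (𝓟 M) := by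
    by_contra hnot
    rw [accPt_iff_nhds] at hnot
    push Not at hnot
    obtain ⟨U, hU, hUM⟩ := hnot
    have hsub : M ⊆ M \ {u} := by
      refine hmin ⟨?_, ?_, ?_⟩
      · have : M \ {u} = M ∩ (interior U)ᶜ := by
          ext y
          constructor
          · rintro ⟨hy, hyu⟩
            exact ⟨hy, fun hyU => hyu (hUM y ⟨interior_subset hyU, hy⟩)⟩
          · rintro ⟨hy, hyU⟩
            refine ⟨hy, fun hyu => hyU ?_⟩
            rw [Set.mem_singleton_iff.1 hyu]
            exact mem_interior_iff_mem_nhds.2 hU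
        rw [this]
        exact hcl.inter isOpen_interior.isClosed_compl
      · obtain ⟨w, hw, hwu⟩ := hother
        exact ⟨w, hinv' u hu w hw, hwu⟩
      · rintro z ⟨hz, hzu⟩ w hw
        refine ⟨hinv z hz w hw, ?_⟩
        rintro rfl
        rcases (isRoot_diffOp_iff hk z w).1 hw with h | h
        · exact hzu h.symm
        · exact hback z hz hzu h
    exact (hsub hu).2 rfl
  -- One accumulation point suffices: the derived set is itself invariant, so it contains `M`.
  refine ⟨hcl, hmin (a := derivedSet M) ⟨isClosed_derivedSet M, ⟨u, hacc⟩, ?_⟩⟩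
  intro z hz w hw
  rcases (isRoot_diffOp_iff hk z w).1 hw with rfl | hw
  · exact hz
  rw [mem_derivedSet, accPt_iff_nhds]
  intro U hU
  obtain ⟨δ, hδ, hball⟩ := Metric.mem_nhds_iff.1 hU
  have hfin := (finite_setOf_residual_isRoot (Q := Q) hk.le (hcommon w)).subset
    (Set.sdiff_subset (t := {z}))
  have h₁ := eventually_exists_root_near hw hd hc hdeg hδ
  -- Points `z' ≠ z` near `z` do not have `w` as a residual root, so the nearby root `r` differs
  -- from `w`.
  have h₂ : ({z' | (residual k Q n z').IsRoot w} \ {z})ᶜ ∈ 𝓝 z :=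
    hfin.isClosed.isOpen_compl.mem_nhds fun h => h.2 rfl
  rw [mem_derivedSet, accPt_iff_nhds] at hz
  obtain ⟨z', ⟨⟨⟨r, hr, hlt⟩, hz'⟩, hz'M⟩, hne⟩ := hz _ (inter_mem h₁ h₂)
  refine ⟨r, ⟨hball ?_, hinv' z' hz'M r hr⟩, ?_⟩
  · rwa [Metric.mem_ball, dist_comm, dist_eq_norm]
  · rintro rfl
    exact hz' ⟨hr, hne⟩

end Perfectness

end Hutchinson

/-! ### The main theorem. -/

theorem mainTheorem4 (k : ℕ) (hk : 1 ≤ k) (Q : ℕ → Polynomial ℂ)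
    (hT : Hutchinson.NonDegenerate k Q)
    (hsimple : ∃ u₀ : ℂ, (Q k).rootMultiplicity u₀ = 1) :
    ∀ ε : ℝ, 0 < ε → ∃ N : ℕ, ∀ n : ℕ, N ≤ n →
      ∃ S : Set ℂ, Hutchinson.IsMinimalInvariant (Hutchinson.diffOp k Q) n S ∧
        S ⊆ Metric.thickening ε {w : ℂ | (Q k).IsRoot w} ∧
        {u : ℂ | (Q k).rootMultiplicity u = 1} ⊆ S ∧
        (2 ≤ k → (∃ j < k, Q j ≠ 0) →
          2 ≤ (Q k).natDegree → (∀ w : ℂ, ∃ j ≤ k, ¬ (Q j).IsRoot w) →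
          Perfect S) := by
  open Hutchinson Polynomial Filter in
  intro ε hε
  rw [← eventually_atTop]
  obtain ⟨u, hu⟩ := hsimple
  obtain ⟨hu0, hu1⟩ := (simple_root_iff hT.1 u).1 hu
  have hfin : {w | (Q k).rootMultiplicity w = 1}.Finite := by
    refine ((Q k).roots.toFinset.finite_toSet).subset fun w hw => ?_
    simpa [hT.1] using ((simple_root_iff hT.1 w).1 hw).1
  have hq : 0 < ‖(Q k).leadingCoeff‖ := norm_pos_iff.2 (leadingCoeff_ne_zero.2 hT.1)
  set K : Set ℂ := ⋃ r ∈ {w | (Q k).IsRoot w}, Metric.closedBall r (ε / 2)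
  have hbdd : Bornology.IsBounded K := by
    refine (Bornology.isBounded_biUnion ?_).2 fun r _ => Metric.isBounded_closedBall
    refine ((Q k).roots.toFinset.finite_toSet).subset fun w hw => ?_
    simpa [hT.1] using hw
  obtain ⟨B, hB⟩ := hbdd.subset_closedBall u
  -- The hypothesis sits inside the filter because `N` is fixed before it is assumed.
  have hback : ∀ᶠ n in atTop, (∀ w : ℂ, ∃ j ≤ k, ¬ (Q j).IsRoot w) →
      ∀ z ≠ u, ‖u - z‖ ≤ B → ¬ (residual k Q n z).IsRoot u := by
    by_cases hc : ∀ w : ℂ, ∃ j ≤ k, ¬ (Q j).IsRoot w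
    · filter_upwards [eventually_not_isRoot (hc u)] with n hn _ using hn
    · exact Eventually.of_forall fun n h => absurd h hc
  filter_upwards [eventually_isInvariant_neighbourhood hT ⟨u, hu0⟩ (half_pos hε),
    (eventually_all_finite hfin).2 fun w hw => eventually_exists_root_closer hT hw,
    eventually_natDegree_residual hT, eventually_derivative_ne hu1, hback,
    eventually_gt_atTop k] with n hinv hcloser hdeg hder hback hkn
  have hmem : ∀ w, (Q k).rootMultiplicity w = 1 → ∀ S, IsInvariant (diffOp k Q) n S → w ∈ S :=
    fun w hw S hS => hS.mem_of_closer fun z hz => by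
      obtain ⟨v, hv, hlt⟩ := hcloser w hw z hz
      exact ⟨v, (isRoot_diffOp_iff hkn z v).2 (Or.inr hv), hlt⟩
  have hmin := isMinimalInvariant_sInter (hmem u hu)
  have hSK : ⋂₀ {S | IsInvariant (diffOp k Q) n S} ⊆ K := Set.sInter_subset_of_mem hinv
  refine ⟨_, hmin, hSK.trans ?_, fun w hw => Set.mem_sInter.2 (hmem w hw), ?_⟩
  · refine Set.iUnion₂_subset fun r hr z hz => Metric.mem_thickening_iff.2 ⟨r, hr, ?_⟩
    have := Metric.mem_closedBall.1 hz
    linarith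
  · intro _ _ hd hcommon
    refine hmin.perfect hkn (by omega) (half_pos hq) hdeg hcommon
      (Set.mem_sInter.2 (hmem u hu)) ?_ fun z hz hzu => hback hcommon z hzu ?_
    · refine exists_root_ne ((hdeg u).1.symm ▸ hd) ?_ ?_
      -- At `z = u` every lower term carries a positive power of `u - u`, so the value is `Q_k(u) =
      -- 0`.
      · rw [IsRoot.def, eval_residual, Finset.sum_range_succ, Finset.sum_eq_zero]
        · simp [IsRoot.def.1 hu0]
        · intro j hj
          have := Finset.mem_range.1 hj
          simp [show k - j ≠ 0 by omega]
      · have h₁ := hder u (by simp)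
        have h₂ := norm_pos_iff.2 hu1
        rw [← norm_pos_iff]
        linarith
    · have := hB (hSK hz)
      rw [Metric.mem_closedBall, dist_comm, dist_eq_norm] at this
      exact this
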